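/- Let $m\ge 1$ and $n,j\ge 0$ be integers and let $[n]=\{1,\dots,n\}$. The $m$-Catalan arrangement in $\mathbb{R}^n$ is the finite set $\mathcal{A}$ of hyperplanes $\{x\in\mathbb{R}^n : x_a-x_b=k\}$ with $1\le a<b\le n$ and $k\in\{-m,\dots,m\}$. Let $L(\mathcal{A})$ be the poset of all non-empty intersections of hyperplanes of $\mathcal{A}$ (including $\mathbb{R}^n$, the empty intersection), ordered by reverse inclusion, let $\mu$ be its Möbius function and $\hat 0=\mathbb{R}^n$ its least element, and let $$\chi_{\mathcal{A}}(t)=\sum_{x\in L(\mathcal{A})}\mu(\hat 0,x)\,t^{\dim x}$$ be the characteristic polynomial of $\mathcal{A}$. Let $C(m,n,j)$ be the absolute value of the coefficient of $t^j$ in $\chi_{\mathcal{A}}(t)$. A labeled $m$-Dyck path on $[n]$ is a sequence of $(m+1)n$ terms such that $n$ terms are $+m$, $mn$ terms are $-1$, the sum of every prefix is non-negative, and the $+m$ terms carry pairwise distinct labels from $[n]$. Cutting the sequence after each non-empty prefix whose sum is $0$ (that is, each time the path returns to the $x$-axis) breaks it into consecutive primitive parts. The primitive parts are grouped into compartments as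 follows: the first compartment consists of the primitive parts up to and including the one that contains the label $n$; the second consists of the following primitive parts up to and including the one that contains the largest label not in the first compartment; and so on, each new compartment ending with the primitive part that contains the largest label not in the previous compartments, until all primitive parts are used. (For $n=0$ the empty path has no compartments.) Then the number of labeled $m$-Dyck paths on $[n]$ with exactly $j$ compartments is $C(m,n,j)$. -/

import Mathlib

namespace CatalanArr

/-! Hyperplane arrangements and their characteristic polynomials -/

noncomputable section

/-- The hyperplane `x_i - x_j = k` in `ℝⁿ`, as an affine subspace. -/
def hyperplane {n : ℕ} (i j : Fin n) (k : ℤ) : AffineSubspace ℝ (Fin n → ℝ) where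
  carrier := {x | x i - x j = (k : ℝ)}
  smul_vsub_vadd_mem' := by
    intro c p q r hp hq hr
    simp only [Set.mem_ofPred_eq, vsub_eq_sub, vadd_eq_add, Pi.add_apply, Pi.smul_apply,
      Pi.sub_apply, smul_eq_mul] at *
    linear_combination c * hp - c * hq + hr

open Classical in
/-- The arrangement in `ℝⁿ` consisting of the hyperplanes `x_i - x_j = k` for `k ∈ S` and
`i < j`. -/
def braidDeformation (S : Finset ℤ) (n : ℕ) : Finset (AffineSubspace ℝ (Fin n → ℝ)) :=
  ((Finset.univ.filter fun p : Fin n × Fin n => p.1 < p.2) ×ˢ S).image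
    fun q => hyperplane q.1.1 q.1.2 q.2

/-- The `m`-Catalan arrangement in `ℝⁿ`: the case `S = {-m, …, m}`. -/
def catalanArrangement (m n : ℕ) : Finset (AffineSubspace ℝ (Fin n → ℝ)) :=
  braidDeformation (Finset.Icc (-(m : ℤ)) (m : ℤ)) n

/-- The intersection poset of a finite set `A` of hyperplanes: the non-empty intersections of
subsets of `A` (the whole space being the intersection of no hyperplane), ordered by reverse
inclusion; the reversal of the order comes from the order dual. -/
abbrev IntersectionPoset {n : ℕ} (A : Finset (AffineSubspace ℝ (Fin n → ℝ))) : Type :=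
  {x : (AffineSubspace ℝ (Fin n → ℝ))ᵒᵈ //
    ((OrderDual.ofDual x : AffineSubspace ℝ (Fin n → ℝ)) : Set (Fin n → ℝ)).Nonempty ∧
      ∃ B : Finset (AffineSubspace ℝ (Fin n → ℝ)), B ⊆ A ∧
        OrderDual.ofDual x = sInf (B : Set (AffineSubspace ℝ (Fin n → ℝ)))}

instance instFiniteIntersectionPoset {n : ℕ}
    (A : Finset (AffineSubspace ℝ (Fin n → ℝ))) :
    Finite (IntersectionPoset A) := by
  refine Finite.of_injective (β := {B : Finset (AffineSubspace ℝ (Fin n → ℝ)) // B ∈ A.powerset})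
    (fun x => ⟨x.2.2.choose, Finset.mem_powerset.2 x.2.2.choose_spec.1⟩) ?_
  intro x y h
  have hB : x.2.2.choose = y.2.2.choose := congrArg Subtype.val h
  have hx := x.2.2.choose_spec.2
  rw [hB, ← y.2.2.choose_spec.2] at hx
  exact Subtype.ext hx

instance instFintypeIntersectionPoset {n : ℕ}
    (A : Finset (AffineSubspace ℝ (Fin n → ℝ))) :
    Fintype (IntersectionPoset A) := Fintype.ofFinite _

open Classical in
instance instLocallyFiniteOrderIntersectionPoset {n : ℕ}
    (A : Finset (AffineSubspace ℝ (Fin n → ℝ))) :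
    LocallyFiniteOrder (IntersectionPoset A) := Fintype.toLocallyFiniteOrder

/-- The least element of the intersection poset, namely the whole space. -/
def ambient {n : ℕ} (A : Finset (AffineSubspace ℝ (Fin n → ℝ))) : IntersectionPoset A :=
  ⟨OrderDual.toDual ⊤, ⟨0, trivial⟩, ∅, by simp, by simp⟩

open Classical in
/-- The characteristic polynomial `∑_x μ(0̂, x) t ^ dim x`, where `x` ranges over the
intersection poset and `μ` is its Möbius function. -/
def characteristicPolynomial {n : ℕ} (A : Finset (AffineSubspace ℝ (Fin n → ℝ))) :
    Polynomial ℤ :=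
  ∑ x : IntersectionPoset A,
    Polynomial.C (IncidenceAlgebra.mu ℤ (ambient A) x) *
      Polynomial.X ^ Module.finrank ℝ (OrderDual.ofDual x.1).direction

/-- `C(m,n,j)`: the absolute value of the coefficient of `t ^ j` in the characteristic
polynomial of the `m`-Catalan arrangement in `ℝⁿ`. -/
def catalanCoeff (m n j : ℕ) : ℕ :=
  ((characteristicPolynomial (catalanArrangement m n)).coeff j).natAbs

end

/-! Labeled Dyck paths and their compartments -/

/-- A step of a labeled `m`-Dyck path: a term `+m` carrying a label, or a term `-1`. -/
inductive Step where
  | up (label : ℕ) : Step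
  | down : Step
  deriving DecidableEq

/-- The value of a step: `+m` or `-1`. -/
def Step.value (m : ℕ) : Step → ℤ
  | .up _ => (m : ℤ)
  | .down => -1

/-- The label of a step, if it has one. -/
def Step.label? : Step → Option ℕ
  | .up a => some a
  | .down => none

/-- The sum of the terms of a sequence. -/
def height (m : ℕ) (w : List Step) : ℤ := (w.map (Step.value m)).sum

/-- The labels of the `+m` terms of a sequence, in order. -/
def labels (w : List Step) : List ℕ := w.filterMap Step.label?

/-- `w` is a labeled `m`-Dyck path on `[n] = {1, …, n}`. -/
structure IsLabeledDyckPath (m n : ℕ) (w : List Step) : Prop where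
  length_eq : w.length = (m + 1) * n
  up_count : (labels w).length = n
  down_count : w.count Step.down = m * n
  prefix_nonneg : ∀ p : List Step, p <+: w → 0 ≤ height m p
  labels_nodup : (labels w).Nodup
  labels_mem : ∀ a ∈ labels w, a ∈ Finset.Icc 1 n

/-- Auxiliary function for `primitiveParts`: `cur` is the part of the path read since the last
visit to the `x`-axis, the second argument is what remains to be read. -/
def primitivePartsAux (m : ℕ) : List Step → List Step → List (List Step)
  | cur, [] => if cur = [] then [] else [cur]
  | cur, s :: rest =>
    if height m (cur ++ [s]) = 0 then (cur ++ [s]) :: primitivePartsAux m [] rest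
    else primitivePartsAux m (cur ++ [s]) rest

/-- The primitive parts of a path: it is cut each time it touches the `x`-axis. -/
def primitiveParts (m : ℕ) (w : List Step) : List (List Step) := primitivePartsAux m [] w

/-- The largest label that occurs in a list of parts. (Labels are positive; the value is `0`
if there is no label.) -/
def maxLabel (ps : List (List Step)) : ℕ := (labels ps.flatten).foldr max 0

/-- Group a list of primitive parts into compartments: the first compartment consists of the
parts up to and including the one that contains the largest label, and one continues in the
same way with the remaining parts and the labels in them. -/
def groupParts : List (List Step) → List (List (List Step))
  | [] => []
  | p :: ps =>
    let i := (p :: ps).findIdx fun q => decide (maxLabel (p :: ps) ∈ labels q)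
    (p :: ps).take (i + 1) :: groupParts ((p :: ps).drop (i + 1))
  termination_by l => l.length
  decreasing_by simp

/-- The compartments of a labeled `m`-Dyck path, each given as its list of primitive parts. -/
def compartments (m : ℕ) (w : List Step) : List (List (List Step)) :=
  groupParts (primitiveParts m w)

end CatalanArr

namespace CatalanArr

/-! Both sides are read off from one polynomial, $F_n(t)=t(t+mn+1)\cdots(t+mn+n-1)$ with $F_0=1$
(`fuss`, `fussPoly`).

Path side: $F_n(t)$ is the generating function $\sum_w t^{\#\mathrm{compartments}(w)}$ over labeled
paths. A first-step recurrence shows that $F_n(h+1)$ counts labeled paths from height $h$ to $0$, so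
$F_n(1)$ is the total number of paths. Splitting off the first compartment, whose labels are the
maximum together with some subset of the others, gives a recursion for the generating function
(`sum_paths_insert`) of the same shape as a convolution identity for $F$ (`fuss_convolution`).
Comparing the two at $t=1$ determines the number of one-compartment paths by induction, and the
recursion then gives $F_n(t)$ for all $t$.

Arrangement side: $\chi(t)=(-1)^nF_n(-t)$. Whitney's formula and inclusion–exclusion show that
$\chi(q)$, for large $q$, counts the points of $(\mathbb{Z}/q)^n$ off the hyperplanes; $q$ need not
be prime. Such points are placements of $n$ blocks of length $m+1$ on a circle of length $q$, which
are counted directly. Taking absolute values removes the signs, since the coefficients of $F_n$ are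
cardinalities. -/

/-! ### The polynomials $F_n$ and their convolution identity. -/

/-- The value at `t` of the polynomial `t (t + mn + 1) ⋯ (t + mn + n - 1)`. -/
def fuss (m : ℕ) : ℕ → ℕ → ℕ
  | 0, _ => 1
  | n + 1, t => t * (t + m * (n + 1) + 1).ascFactorial n

/-- The linear coefficient of `fuss m (k + 1)`. -/
def fussLin (m k : ℕ) : ℕ := (m * (k + 1) + 1).ascFactorial k

theorem ascFactorial_succ_left (a n : ℕ) :
    (a + 1).ascFactorial (n + 1) = (a + 1) * (a + 2).ascFactorial n := by
  induction n with
  | zero => simp [Nat.ascFactorial]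
  | succ n ih =>
    rw [Nat.ascFactorial_succ, ih, Nat.ascFactorial_succ]; ring

theorem ascFactorial_succ_base (a n : ℕ) :
    (a + 1).ascFactorial (n + 1) = a.ascFactorial (n + 1) + (n + 1) * (a + 1).ascFactorial n := by
  have h : a.ascFactorial (n + 1) = a * (a + 1).ascFactorial n := by
    cases a with
    | zero => simp [Nat.zero_ascFactorial]
    | succ a => exact ascFactorial_succ_left a n
  rw [h, Nat.ascFactorial_succ]; ring

theorem fuss_succ_zero (m n : ℕ) : fuss m (n + 1) 0 = 0 := by simp [fuss]

/-- The forward difference in `t` lowers the index by one and shifts the argument by `m`; the first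
step of a path obeys the same recurrence. -/
theorem fuss_succ_succ (m n t : ℕ) :
    fuss m (n + 1) (t + 1) = fuss m (n + 1) t + (n + 1) * fuss m n (t + 1 + m) := by
  cases n with
  | zero => simp [fuss]
  | succ n =>
    simp only [fuss]
    have e1 : t + 1 + m * (n + 1 + 1) + 1 = (t + m * (n + 2) + 1) + 1 := by ring
    have e2 : t + 1 + m + m * (n + 1) + 1 = (t + m * (n + 2) + 1) + 1 := by ring
    have e3 : t + m * (n + 1 + 1) + 1 = t + m * (n + 2) + 1 := by ring
    rw [e1, e2, e3, ascFactorial_succ_left (t + m * (n + 2)) n, Nat.ascFactorial_succ]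
    ring

/-- The left side is $F_{n+1}(t)/t$. Both sides agree at `t = 0`, where only `k = n` survives, and
both have forward difference `n` times their version for `n - 1` at `t + 1 + m`. -/
theorem fuss_convolution_aux (m n t : ℕ) :
    (t + m * (n + 1) + 1).ascFactorial n =
      ∑ k ∈ Finset.range (n + 1), n.choose k * (fussLin m k * fuss m (n - k) t) := by
  induction n generalizing t with
  | zero => simp [fuss, fussLin]
  | succ n ihn =>
    induction t with
    | zero =>
      rw [Finset.sum_range_succ, Finset.sum_eq_zero]
      · simp [fussLin, fuss]
      · intro k hk
        obtain ⟨d, rfl⟩ := Nat.exists_eq_add_of_le (Nat.lt_succ_iff.1 (Finset.mem_range.1 hk))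
        have : k + d + 1 - k = d + 1 := by omega
        rw [this, fuss_succ_zero]; simp
    | succ t iht =>
      have e1 : t + 1 + m * (n + 1 + 1) + 1 = (t + m * (n + 1 + 1) + 1) + 1 := by ring
      rw [e1, ascFactorial_succ_base, iht]
      have e2 : t + m * (n + 1 + 1) + 1 + 1 = (t + 1 + m) + m * (n + 1) + 1 := by ring
      rw [e2, ihn, Finset.sum_range_succ _ (n + 1), Finset.sum_range_succ _ (n + 1),
        Finset.mul_sum, add_right_comm, ← Finset.sum_add_distrib]
      congr 1
      · refine Finset.sum_congr rfl fun k hk => ?_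
        obtain ⟨d, rfl⟩ := Nat.exists_eq_add_of_le (Nat.lt_succ_iff.1 (Finset.mem_range.1 hk))
        have h1 : k + d + 1 - k = d + 1 := by omega
        have h2 : k + d - k = d := by omega
        rw [h1, h2, fuss_succ_succ]
        have h3 : (k + d + 1).choose k * (d + 1) = (k + d + 1) * (k + d).choose k := by
          have := Nat.choose_mul_succ_eq (k + d) k
          rw [h1] at this
          rw [← this]; ring
        calc _ = (k + d + 1).choose k * (fussLin m k * fuss m (d + 1) t) +
              ((k + d + 1) * (k + d).choose k) * (fussLin m k * fuss m d (t + 1 + m)) := by ring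
          _ = _ := by rw [← h3]; ring
      · simp [fuss]

theorem fuss_convolution (m n t : ℕ) :
    fuss m (n + 1) t =
      t * ∑ k ∈ Finset.range (n + 1), n.choose k * (fussLin m k * fuss m (n - k) t) := by
  rw [← fuss_convolution_aux]; rfl

/-! ### Counting labeled paths by their first step. -/

/-- `w` leads from height `h` to height `0` without going below `0`, and its labels are the
elements of `S`, each used once. -/
def IsWord (m : ℕ) : ℕ → Finset ℕ → List Step → Prop
  | h, S, [] => h = 0 ∧ S = ∅
  | h, S, Step.down :: w => ∃ h', h = h' + 1 ∧ IsWord m h' S w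
  | h, S, Step.up a :: w => a ∈ S ∧ IsWord m (h + m) (S.erase a) w

/-- Induction on the word length $h+(m+1)|S|$. A first step down leaves height $h-1$; a first step
up has $|S|$ possible labels and leads to height $h+m$. These are the two terms of `fuss_succ_succ`
at `t = h`, the first vanishing when `h = 0`. -/
theorem exists_finset_isWord (m h : ℕ) (S : Finset ℕ) :
    ∃ F : Finset (List Step), (∀ w, w ∈ F ↔ IsWord m h S w) ∧
      F.card = fuss m S.card (h + 1) := by
  classical
  induction hL : h + (m + 1) * S.card using Nat.strong_induction_on generalizing h S with
  | _ L ih =>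
  subst hL
  have hup : ∀ a : ℕ, ∃ F : Finset (List Step), a ∈ S → (∀ w, w ∈ F ↔ IsWord m (h + m) (S.erase a) w) ∧
      F.card = fuss m (S.card - 1) (h + m + 1) := by
    intro a
    by_cases ha : a ∈ S
    · have hc := Finset.card_erase_of_mem ha
      have hpos := Finset.card_pos.2 ⟨a, ha⟩
      obtain ⟨k, hk⟩ : ∃ k, S.card = k + 1 := ⟨S.card - 1, by omega⟩
      obtain ⟨F, hF⟩ := ih (h + m + (m + 1) * (S.erase a).card) (by
        rw [hc, hk, Nat.add_sub_cancel]; nlinarith) (h + m) (S.erase a) rfl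
      exact ⟨F, fun _ => by rw [← hc]; exact hF⟩
    · exact ⟨∅, fun h => absurd h ha⟩
  choose U hU using hup
  have hdown : ∃ F : Finset (List Step), (∀ w, w ∈ F ↔ ∃ h', h = h' + 1 ∧ IsWord m h' S w) ∧
      (h ≠ 0 → F.card = fuss m S.card h) ∧ (h = 0 → F = ∅) := by
    cases h with
    | zero => exact ⟨∅, by simp⟩
    | succ h =>
      obtain ⟨F, hF, hF'⟩ := ih (h + (m + 1) * S.card) (by omega) h S rfl
      exact ⟨F, by simp [hF], fun _ => hF', by simp⟩
  obtain ⟨V, hV, hV1, hV0⟩ := hdown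
  have hinj : ∀ s : Step, Function.Injective (List.cons s) := fun s => List.cons_injective
  let G : Finset (List Step) := V.image (List.cons Step.down) ∪
    S.biUnion fun a => (U a).image (List.cons (Step.up a))
  have hGcard : G.card = V.card + ∑ a ∈ S, (U a).card := by
    rw [Finset.card_union_of_disjoint, Finset.card_image_of_injective _ (hinj _),
      Finset.card_biUnion]
    · congr 1
      exact Finset.sum_congr rfl fun a _ => Finset.card_image_of_injective _ (hinj _)
    · intro a _ b _ hab
      rw [Function.onFun, Finset.disjoint_left]
      simp only [Finset.mem_image, not_exists, not_and, forall_exists_index, and_imp]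
      rintro _ w - rfl v - h
      injection h with h1
      injection h1 with h2
      exact hab h2.symm
    · rw [Finset.disjoint_left]
      simp only [Finset.mem_image, Finset.mem_biUnion, not_exists, not_and, forall_exists_index,
        and_imp]
      rintro _ w - rfl a - v - h
      injection h with h1
      cases h1
  have hGmem : ∀ w, w ∈ G ↔ w ≠ [] ∧ IsWord m h S w := by
    intro w
    simp only [G, Finset.mem_union, Finset.mem_image, Finset.mem_biUnion]
    match w with
    | [] => simp
    | Step.down :: w => simp [hV, IsWord]
    | Step.up b :: w =>
      simp only [IsWord]
      constructor
      · rintro (⟨v, -, h⟩ | ⟨a, ha, v, hv, h⟩)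
        · cases h
        · cases h
          exact ⟨by simp, ha, ((hU _ ha).1 _).1 hv⟩
      · rintro ⟨-, hb, hw⟩
        exact Or.inr ⟨b, hb, w, ((hU _ hb).1 _).2 hw, rfl⟩
  have hsum : ∑ a ∈ S, (U a).card = S.card * fuss m (S.card - 1) (h + m + 1) := by
    rw [Finset.sum_congr rfl fun a ha => (hU a ha).2]; simp
  by_cases h0 : h = 0 ∧ S = ∅
  · obtain ⟨rfl, rfl⟩ := h0
    refine ⟨{[]}, ?_, by simp [fuss]⟩
    intro w
    match w with
    | [] => simp [IsWord]
    | Step.down :: w => simp [IsWord]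
    | Step.up b :: w => simp [IsWord]
  · refine ⟨G, fun w => ?_, ?_⟩
    · rw [hGmem, and_iff_right_iff_imp]
      rintro hw rfl
      exact h0 hw
    · rw [hGcard, hsum]
      rcases hS : S.card with _ | k
      · have hS' := Finset.card_eq_zero.1 hS
        have hh : h ≠ 0 := fun e => h0 ⟨e, hS'⟩
        rw [hV1 hh, hS]; simp [fuss]
      · rw [fuss_succ_succ, Nat.add_sub_cancel, add_right_comm h m 1]
        congr 1
        by_cases hh : h = 0
        · rw [hV0 hh, hh, fuss_succ_zero]; rfl
        · rw [hV1 hh, hS]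

/-- The labeled paths from height `0` to height `0` with label set `S`. -/
noncomputable def paths (m : ℕ) (S : Finset ℕ) : Finset (List Step) :=
  (exists_finset_isWord m 0 S).choose

theorem mem_paths {m : ℕ} {S : Finset ℕ} {w : List Step} : w ∈ paths m S ↔ IsWord m 0 S w :=
  (exists_finset_isWord m 0 S).choose_spec.1 w

theorem card_paths (m : ℕ) (S : Finset ℕ) : (paths m S).card = fuss m S.card 1 :=
  (exists_finset_isWord m 0 S).choose_spec.2

theorem height_cons (m : ℕ) (s : Step) (w : List Step) :
    height m (s :: w) = s.value m + height m w := by simp [height]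

theorem height_append (m : ℕ) (u v : List Step) :
    height m (u ++ v) = height m u + height m v := by simp [height]

theorem labels_append (u v : List Step) : labels (u ++ v) = labels u ++ labels v := by
  simp [labels]

theorem labels_down_cons (w : List Step) : labels (Step.down :: w) = labels w := rfl

theorem labels_up_cons (a : ℕ) (w : List Step) : labels (Step.up a :: w) = a :: labels w := rfl

theorem isWord_iff {m h : ℕ} {S : Finset ℕ} {w : List Step} :
    IsWord m h S w ↔ (labels w).Nodup ∧ (labels w).toFinset = S ∧ (h : ℤ) + height m w = 0 ∧
      ∀ p : List Step, p <+: w → 0 ≤ (h : ℤ) + height m p := by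
  induction w generalizing h S with
  | nil =>
    simp only [IsWord, labels, height]
    constructor
    · rintro ⟨rfl, rfl⟩; simp
    · rintro ⟨-, h1, h2, -⟩
      simp at h1 h2
      exact ⟨h2, h1.symm⟩
  | cons s w ih =>
    have hp : (∀ p : List Step, p <+: s :: w → 0 ≤ (h : ℤ) + height m p) ↔
        ∀ p : List Step, p <+: w → 0 ≤ (h : ℤ) + s.value m + height m p := by
      constructor
      · intro H p hp
        have := H (s :: p) (by simpa using hp)
        rw [height_cons] at this; linarith
      · intro H p hp
        rcases p with _ | ⟨s', p⟩
        · simp [height]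
        · obtain ⟨rfl, hp'⟩ := List.cons_prefix_cons.1 hp
          have := H p hp'
          rw [height_cons]; linarith
    rw [hp, height_cons]
    cases s with
    | down =>
      simp only [IsWord, ih, Step.value, labels, List.filterMap_cons, Step.label?]
      constructor
      · rintro ⟨h', rfl, h1, h2, h3, h4⟩
        refine ⟨h1, h2, by push_cast; linarith, fun p hp => ?_⟩
        have := h4 p hp
        push_cast; linarith
      · rintro ⟨h1, h2, h3, h4⟩
        have h0 := h4 [] (by simp)
        simp [height] at h0
        obtain ⟨h', rfl⟩ : ∃ h', h = h' + 1 := ⟨h - 1, by omega⟩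
        refine ⟨h', rfl, h1, h2, by push_cast at h3; linarith, fun p hp => ?_⟩
        have := h4 p hp
        push_cast at this; linarith
    | up a =>
      simp only [IsWord, ih, Step.value, labels, List.filterMap_cons, Step.label?,
        List.nodup_cons, List.toFinset_cons]
      constructor
      · rintro ⟨ha, h1, h2, h3, h4⟩
        refine ⟨⟨fun hm => ?_, h1⟩, ?_, by push_cast at h3; linarith, by simpa using h4⟩
        · have := List.mem_toFinset.2 hm
          rw [h2] at this
          simp at this
        · rw [h2, Finset.insert_erase ha]
      · rintro ⟨⟨h0, h1⟩, rfl, h3, h4⟩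
        refine ⟨by simp, h1, ?_, by push_cast; linarith, by simpa using h4⟩
        rw [Finset.erase_insert (by simpa using h0)]

theorem length_eq_labels_add_count (w : List Step) :
    w.length = (labels w).length + w.count Step.down := by
  induction w with
  | nil => simp [labels]
  | cons s w ih =>
    cases s with
    | down => rw [labels_down_cons]; simp; omega
    | up a => rw [labels_up_cons]; simp; omega

theorem height_eq (m : ℕ) (w : List Step) :
    height m w = m * (labels w).length - w.count Step.down := by
  induction w with
  | nil => simp [labels, height]
  | cons s w ih =>
    rw [height_cons, ih]
    cases s with
    | down => rw [labels_down_cons]; simp [Step.value]; ring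
    | up a => rw [labels_up_cons]; simp [Step.value]; ring

/-- The step counts are redundant: the label set forces `n` up steps, and final height `0` then
forces `m * n` down steps. -/
theorem isLabeledDyckPath_iff {m n : ℕ} {w : List Step} :
    IsLabeledDyckPath m n w ↔ w ∈ paths m (Finset.Icc 1 n) := by
  rw [mem_paths, isWord_iff]
  have hl := length_eq_labels_add_count w
  have hh := height_eq m w
  constructor
  · intro H
    refine ⟨H.labels_nodup, ?_, ?_, by simpa using H.prefix_nonneg⟩
    · refine Finset.eq_of_subset_of_card_le (fun a ha => H.labels_mem a (List.mem_toFinset.1 ha)) ?_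
      rw [List.toFinset_card_of_nodup H.labels_nodup, H.up_count]; simp
    · rw [hh, H.up_count, H.down_count]; push_cast; ring
  · rintro ⟨h1, h2, h3, h4⟩
    have hn : (labels w).length = n := by
      rw [← List.toFinset_card_of_nodup h1, h2]; simp
    have hd : w.count Step.down = m * n := by
      rw [hh, hn] at h3
      push_cast at h3
      have : (w.count Step.down : ℤ) = ((m * n : ℕ) : ℤ) := by push_cast; linarith
      exact_mod_cast this
    refine ⟨by rw [hl, hn, hd]; ring, hn, hd, by simpa using h4, h1, fun a ha => ?_⟩
    rw [← h2]; exact List.mem_toFinset.2 ha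

/-! ### Factorization into primitive parts. -/

/-- A nonempty sequence of height `0` whose proper nonempty prefixes do not have height `0`. -/
def IsPrimitive (m : ℕ) (p : List Step) : Prop :=
  p ≠ [] ∧ height m p = 0 ∧ ∀ q, q <+: p → q ≠ [] → height m q = 0 → q = p

theorem flatten_primitivePartsAux (m : ℕ) (cur w : List Step) :
    (primitivePartsAux m cur w).flatten = cur ++ w := by
  induction w generalizing cur with
  | nil => by_cases h : cur = [] <;> simp [primitivePartsAux, h]
  | cons s w ih =>
    by_cases h : height m (cur ++ [s]) = 0 <;> simp [primitivePartsAux, h, ih]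

theorem flatten_primitiveParts (m : ℕ) (w : List Step) : (primitiveParts m w).flatten = w :=
  flatten_primitivePartsAux m [] w

/-- No proper non-empty prefix of `cur ++ w` has height `0`, so the first cut falls exactly at its
end. -/
theorem primitivePartsAux_append {m : ℕ} {cur w : List Step} (v : List Step) (hw : w ≠ [])
    (h : IsPrimitive m (cur ++ w)) :
    primitivePartsAux m cur (w ++ v) = (cur ++ w) :: primitivePartsAux m [] v := by
  induction w generalizing cur with
  | nil => exact absurd rfl hw
  | cons s w ih =>
    rw [List.cons_append, primitivePartsAux]
    by_cases h0 : height m (cur ++ [s]) = 0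
    · have h1 := h.2.2 (cur ++ [s]) ⟨w, by simp⟩ (by simp) h0
      have hw' : w = [] := by simpa using h1
      subst hw'
      simp [h0]
    · have hw' : w ≠ [] := by
        rintro rfl
        exact h0 h.2.1
      rw [if_neg h0, ih hw' (by simpa using h)]
      simp

theorem primitiveParts_append {m : ℕ} {u : List Step} (v : List Step) (h : IsPrimitive m u) :
    primitiveParts m (u ++ v) = u :: primitiveParts m v := by
  have := primitivePartsAux_append (cur := []) v h.1 (by simpa using h)
  simpa [primitiveParts] using this

theorem primitiveParts_flatten {m : ℕ} {ps : List (List Step)} (h : ∀ p ∈ ps, IsPrimitive m p) :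
    primitiveParts m ps.flatten = ps := by
  induction ps with
  | nil => simp [primitiveParts, primitivePartsAux]
  | cons p ps ih =>
    rw [List.flatten_cons, primitiveParts_append _ (h p (by simp)),
      ih fun q hq => h q (List.mem_cons_of_mem _ hq)]

/-- The invariant is that `cur` has not returned to the axis. Total height `0` rules out an
unfinished part at the end. -/
theorem isPrimitive_of_mem_primitivePartsAux {m : ℕ} {cur w : List Step}
    (h0 : height m (cur ++ w) = 0) (hcur : ∀ q, q <+: cur → q ≠ [] → height m q ≠ 0) :
    ∀ p ∈ primitivePartsAux m cur w, IsPrimitive m p := by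
  induction w generalizing cur with
  | nil =>
    by_cases h : cur = []
    · simp [primitivePartsAux, h]
    · exact absurd (by simpa using h0) (hcur cur (List.prefix_refl _) h)
  | cons s w ih =>
    rw [primitivePartsAux]
    by_cases h : height m (cur ++ [s]) = 0
    · rw [if_pos h]
      intro p hp
      rcases List.mem_cons.1 hp with rfl | hp
      · refine ⟨by simp, h, fun q hq hq0 hq1 => ?_⟩
        rcases List.prefix_concat_iff.1 hq with rfl | hq
        · rfl
        · exact absurd hq1 (hcur q hq hq0)
      · refine ih ?_ ?_ p hp
        · have e : cur ++ s :: w = (cur ++ [s]) ++ w := by simp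
          rw [e, height_append, h] at h0
          simpa using h0
        · intro q hq hq0
          exact absurd (List.prefix_nil.1 hq) hq0
    · rw [if_neg h]
      refine ih (by simpa using h0) fun q hq hq0 hq1 => ?_
      rcases List.prefix_concat_iff.1 hq with rfl | hq
      · exact h hq1
      · exact hcur q hq hq0 hq1

theorem isPrimitive_of_mem_primitiveParts {m : ℕ} {w : List Step} (h0 : height m w = 0) :
    ∀ p ∈ primitiveParts m w, IsPrimitive m p :=
  isPrimitive_of_mem_primitivePartsAux (by simpa using h0) fun q hq hq0 =>
    absurd (List.prefix_nil.1 hq) hq0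

theorem height_flatten_of_isPrimitive {m : ℕ} {ps : List (List Step)}
    (h : ∀ p ∈ ps, IsPrimitive m p) : height m ps.flatten = 0 := by
  induction ps with
  | nil => simp [height]
  | cons p ps ih =>
    rw [List.flatten_cons, height_append, (h p (by simp)).2.1,
      ih fun q hq => h q (List.mem_cons_of_mem _ hq)]
    rfl

theorem primitiveParts_append_of_height {m : ℕ} {u v : List Step} (hu : height m u = 0)
    (hv : height m v = 0) :
    primitiveParts m (u ++ v) = primitiveParts m u ++ primitiveParts m v := by
  conv_lhs => rw [← flatten_primitiveParts m u, ← flatten_primitiveParts m v, ← List.flatten_append]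
  refine primitiveParts_flatten fun p hp => ?_
  rcases List.mem_append.1 hp with hp | hp
  · exact isPrimitive_of_mem_primitiveParts hu p hp
  · exact isPrimitive_of_mem_primitiveParts hv p hp

/-! ### Grouping parts into compartments. -/

theorem foldr_max_eq_sup (l : List ℕ) : l.foldr max 0 = l.toFinset.sup id := by
  induction l with
  | nil => simp
  | cons a l ih => simp [ih]

theorem maxLabel_eq {ps : List (List Step)} {M : ℕ} (hM : M ∈ labels ps.flatten)
    (h : ∀ a ∈ labels ps.flatten, a ≤ M) : maxLabel ps = M := by
  rw [maxLabel, foldr_max_eq_sup]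
  refine le_antisymm (Finset.sup_le fun a ha => h a (List.mem_toFinset.1 ha)) ?_
  exact Finset.le_sup (f := id) (List.mem_toFinset.2 hM)

theorem mem_labels_flatten {ps : List (List Step)} {a : ℕ} :
    a ∈ labels ps.flatten ↔ ∃ q ∈ ps, a ∈ labels q := by
  simp [labels]

theorem groupParts_of_ne_nil {ps : List (List Step)} (h : ps ≠ []) :
    groupParts ps =
      ps.take ((ps.findIdx fun q => decide (maxLabel ps ∈ labels q)) + 1) ::
        groupParts (ps.drop ((ps.findIdx fun q => decide (maxLabel ps ∈ labels q)) + 1)) := by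
  cases ps with
  | nil => exact absurd rfl h
  | cons p ps => rw [groupParts]

/-- Since `qs` is a single compartment, the first part containing `M` is its last part. Appending
`rs` changes neither the maximum nor that position. -/
theorem groupParts_append {qs rs : List (List Step)} {M : ℕ} (hM : M ∈ labels qs.flatten)
    (hqs : ∀ a ∈ labels qs.flatten, a ≤ M) (hrs : ∀ a ∈ labels rs.flatten, a ≤ M)
    (h1 : (groupParts qs).length = 1) : groupParts (qs ++ rs) = qs :: groupParts rs := by
  have hne : qs ≠ [] := by
    rintro rfl
    simp [groupParts] at h1
  have hm1 : maxLabel qs = M := maxLabel_eq hM hqs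
  have hm2 : maxLabel (qs ++ rs) = M := by
    refine maxLabel_eq ?_ fun a ha => ?_
    · rw [List.flatten_append, labels_append]; exact List.mem_append_left _ hM
    · rw [List.flatten_append, labels_append] at ha
      rcases List.mem_append.1 ha with ha | ha
      · exact hqs a ha
      · exact hrs a ha
  obtain ⟨q, hq, hMq⟩ := mem_labels_flatten.1 hM
  have hlt : (qs.findIdx fun q => decide (M ∈ labels q)) < qs.length :=
    List.findIdx_lt_length_of_exists ⟨q, hq, by simpa using hMq⟩
  rw [groupParts_of_ne_nil hne, hm1] at h1
  have hdrop : qs.drop ((qs.findIdx fun q => decide (M ∈ labels q)) + 1) = [] := by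
    by_contra hd
    rw [groupParts_of_ne_nil hd] at h1
    simp at h1
  have hlen : (qs.findIdx fun q => decide (M ∈ labels q)) + 1 = qs.length :=
    le_antisymm hlt (List.drop_eq_nil_iff.1 hdrop)
  rw [groupParts_of_ne_nil (by simp [hne]), hm2, List.findIdx_append, if_pos hlt, hlen]
  simp

theorem groupParts_split {ps : List (List Step)} {M : ℕ} (hM : M ∈ labels ps.flatten)
    (hps : ∀ a ∈ labels ps.flatten, a ≤ M) :
    ∃ qs rs, ps = qs ++ rs ∧ M ∈ labels qs.flatten ∧ (groupParts qs).length = 1 := by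
  have hm1 : maxLabel ps = M := maxLabel_eq hM hps
  obtain ⟨q, hq, hMq⟩ := mem_labels_flatten.1 hM
  set i := ps.findIdx fun q => decide (M ∈ labels q) with hi
  have hlt : i < ps.length :=
    List.findIdx_lt_length_of_exists ⟨q, hq, by simpa using hMq⟩
  have hMi : M ∈ labels ps[i] := by
    have := List.findIdx_getElem (w := hlt)
    simpa using this
  have hMq : M ∈ labels (ps.take (i + 1)).flatten := by
    refine mem_labels_flatten.2 ⟨ps[i], ?_, hMi⟩
    exact List.mem_take_iff_getElem.2 ⟨i, by omega, rfl⟩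
  have hmq : maxLabel (ps.take (i + 1)) = M := by
    refine maxLabel_eq hMq fun a ha => hps a ?_
    obtain ⟨q, hq, ha⟩ := mem_labels_flatten.1 ha
    exact mem_labels_flatten.2 ⟨q, List.mem_of_mem_take hq, ha⟩
  refine ⟨ps.take (i + 1), ps.drop (i + 1), (List.take_append_drop _ _).symm, hMq, ?_⟩
  have hne : ps.take (i + 1) ≠ [] := by
    intro h
    rw [h] at hMq
    simp [labels] at hMq
  rw [groupParts_of_ne_nil hne, hmq, List.findIdx_take, ← hi, min_eq_right (by omega)]
  have : List.drop (i + 1) (List.take (i + 1) ps) = [] := by simp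
  rw [this]
  simp [groupParts]

/-! ### Splitting off the first compartment, and the generating function. -/

theorem isWord_append_iff {m : ℕ} {S : Finset ℕ} {u v : List Step} (hu : height m u = 0) :
    IsWord m 0 S (u ++ v) ↔
      ∃ T ⊆ S, IsWord m 0 T u ∧ IsWord m 0 (S \ T) v := by
  simp only [isWord_iff, labels_append, height_append, hu, List.nodup_append']
  constructor
  · rintro ⟨⟨h1, h2, h3⟩, h4, h5, h6⟩
    refine ⟨(labels u).toFinset, ?_, ⟨h1, rfl, by simp, fun p hp => h6 p ?_⟩, h2, ?_,
      by simpa using h5, fun p hp => ?_⟩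
    · rw [← h4]; simp
    · exact hp.trans (List.prefix_append _ _)
    · ext a
      have := @h3 a
      rw [← h4]
      simp
      tauto
    · have := h6 (u ++ p) ((List.prefix_append_right_inj u).2 hp)
      rwa [height_append, hu, zero_add] at this
  · rintro ⟨T, hT, ⟨h1, h2, h3, h4⟩, h5, h6, h7, h8⟩
    refine ⟨⟨h1, h5, fun a ha ha' => ?_⟩, ?_, by simpa using h7, fun p hp => ?_⟩
    · have h9 : a ∈ S \ T := by rw [← h6]; simpa using ha'
      have h10 : a ∈ T := by rw [← h2]; simpa using ha
      exact (Finset.mem_sdiff.1 h9).2 h10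
    · rw [List.toFinset_append, h2, h6, Finset.union_sdiff_of_subset hT]
    · rcases List.prefix_or_prefix_of_prefix hp (List.prefix_append u v) with hp' | ⟨q, rfl⟩
      · exact h4 p hp'
      · have hq := (List.prefix_append_right_inj u).1 hp
        rw [height_append, hu, zero_add]; exact h8 q hq

theorem height_eq_zero_of_mem_paths {m : ℕ} {S : Finset ℕ} {w : List Step} (h : w ∈ paths m S) :
    height m w = 0 := by
  simpa using (isWord_iff.1 (mem_paths.1 h)).2.2.1

theorem toFinset_labels_of_mem_paths {m : ℕ} {S : Finset ℕ} {w : List Step} (h : w ∈ paths m S) :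
    (labels w).toFinset = S :=
  (isWord_iff.1 (mem_paths.1 h)).2.1

theorem mem_labels_of_mem_paths {m : ℕ} {S : Finset ℕ} {w : List Step} (h : w ∈ paths m S)
    {a : ℕ} : a ∈ labels w ↔ a ∈ S := by
  rw [← toFinset_labels_of_mem_paths h, List.mem_toFinset]

/-- The labeled paths with label set `S` that consist of a single compartment. -/
noncomputable def onePaths (m : ℕ) (S : Finset ℕ) : Finset (List Step) :=
  (paths m S).filter fun w => (compartments m w).length = 1

theorem compartments_append {m : ℕ} {S T : Finset ℕ} {M : ℕ} (hM : M ∈ T)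
    (hT : ∀ a ∈ T, a ≤ M) (hS : ∀ a ∈ S, a ≤ M) {u v : List Step}
    (hu : u ∈ onePaths m T) (hv : v ∈ paths m S) :
    compartments m (u ++ v) = primitiveParts m u :: compartments m v := by
  obtain ⟨hu, hu1⟩ := Finset.mem_filter.1 hu
  rw [compartments, primitiveParts_append_of_height (height_eq_zero_of_mem_paths hu)
    (height_eq_zero_of_mem_paths hv)]
  refine groupParts_append (M := M) ?_ ?_ ?_ hu1
  · rwa [flatten_primitiveParts, mem_labels_of_mem_paths hu]
  · intro a ha
    rw [flatten_primitiveParts, mem_labels_of_mem_paths hu] at ha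
    exact hT a ha
  · intro a ha
    rw [flatten_primitiveParts, mem_labels_of_mem_paths hv] at ha
    exact hS a ha

theorem exists_split_of_mem_paths {m : ℕ} {S : Finset ℕ} {M : ℕ} (hM : M ∈ S)
    (hS : ∀ a ∈ S, a ≤ M) {w : List Step} (hw : w ∈ paths m S) :
    ∃ T ⊆ S, M ∈ T ∧ ∃ u ∈ onePaths m T, ∃ v ∈ paths m (S \ T), w = u ++ v := by
  have hprim := isPrimitive_of_mem_primitiveParts (height_eq_zero_of_mem_paths hw)
  obtain ⟨qs, rs, hps, hMq, h1⟩ := groupParts_split (ps := primitiveParts m w) (M := M)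
    (by rwa [flatten_primitiveParts, mem_labels_of_mem_paths hw])
    (fun a ha => by
      rw [flatten_primitiveParts, mem_labels_of_mem_paths hw] at ha
      exact hS a ha)
  have hq : ∀ p ∈ qs, IsPrimitive m p := fun p hp => hprim p (by rw [hps]; simp [hp])
  have hwe : w = qs.flatten ++ rs.flatten := by
    rw [← List.flatten_append, ← hps, flatten_primitiveParts]
  have hu0 := height_flatten_of_isPrimitive hq
  have hw' := mem_paths.1 hw
  rw [hwe, isWord_append_iff hu0] at hw'
  obtain ⟨T, hTS, hu, hv⟩ := hw'
  refine ⟨T, hTS, ?_, qs.flatten, ?_, rs.flatten, mem_paths.2 hv, hwe⟩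
  · exact (mem_labels_of_mem_paths (mem_paths.2 hu)).1 hMq
  · refine Finset.mem_filter.2 ⟨mem_paths.2 hu, ?_⟩
    rw [compartments, primitiveParts_flatten hq, h1]

/-- A path factors uniquely as its first compartment, which carries the maximum `M` and a subset `T`
of the other labels, followed by an arbitrary path on `S \ T`. The factor `t` marks the removed
compartment. -/
theorem sum_paths_insert (m t : ℕ) {S : Finset ℕ} {M : ℕ} (hM : ∀ a ∈ S, a < M) :
    ∑ w ∈ paths m (insert M S), t ^ (compartments m w).length =
      t * ∑ T ∈ S.powerset, (onePaths m (insert M T)).card *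
        ∑ v ∈ paths m (S \ T), t ^ (compartments m v).length := by
  have hMS : M ∉ S := fun h => lt_irrefl _ (hM M h)
  have hle : ∀ T ⊆ insert M S, ∀ a ∈ T, a ≤ M := by
    intro T hT a ha
    rcases Finset.mem_insert.1 (hT ha) with rfl | h
    · exact le_rfl
    · exact (hM a h).le
  have hins : ∀ {T}, T ∈ S.powerset → insert M T ⊆ insert M S := fun hT =>
    Finset.insert_subset_insert _ (Finset.mem_powerset.1 hT)
  have hsub : ∀ T, S \ T ⊆ insert M S := fun T =>
    Finset.sdiff_subset.trans (Finset.subset_insert _ _)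
  have key : ∀ {T u v}, T ∈ S.powerset → u ∈ onePaths m (insert M T) → v ∈ paths m (S \ T) →
      compartments m (u ++ v) = primitiveParts m u :: compartments m v := fun hT hu hv =>
    compartments_append (Finset.mem_insert_self _ _) (hle _ (hins hT)) (hle _ (hsub _)) hu hv
  have hrhs : t * ∑ T ∈ S.powerset, (onePaths m (insert M T)).card *
        ∑ v ∈ paths m (S \ T), t ^ (compartments m v).length =
      ∑ x ∈ S.powerset.sigma fun T => onePaths m (insert M T) ×ˢ paths m (S \ T),
        t * t ^ (compartments m x.2.2).length := by
    rw [Finset.sum_sigma, Finset.mul_sum]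
    refine Finset.sum_congr rfl fun T _ => ?_
    rw [Finset.sum_product]
    simp only [← Finset.mul_sum, Finset.sum_const, smul_eq_mul]
  rw [hrhs]
  symm
  refine Finset.sum_bij (fun x _ => x.2.1 ++ x.2.2) ?_ ?_ ?_ ?_
  · rintro ⟨T, u, v⟩ hx
    obtain ⟨hT, hx⟩ := Finset.mem_sigma.1 hx
    obtain ⟨hu, hv⟩ := Finset.mem_product.1 hx
    have hu' := (Finset.mem_filter.1 hu).1
    refine mem_paths.2 ((isWord_append_iff (height_eq_zero_of_mem_paths hu')).2
      ⟨insert M T, hins hT, mem_paths.1 hu', ?_⟩)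
    have : insert M S \ insert M T = S \ T := by
      rw [Finset.insert_sdiff_insert, Finset.sdiff_insert_of_notMem hMS]
    rw [this]
    exact mem_paths.1 hv
  · rintro ⟨T, u, v⟩ hx ⟨T', u', v'⟩ hx' h
    obtain ⟨hT, hx⟩ := Finset.mem_sigma.1 hx
    obtain ⟨hu, hv⟩ := Finset.mem_product.1 hx
    obtain ⟨hT', hx'⟩ := Finset.mem_sigma.1 hx'
    obtain ⟨hu', hv'⟩ := Finset.mem_product.1 hx'
    dsimp only at hT hu hv hT' hu' hv' h
    -- The first compartment of the concatenation recovers `u`; cancellation then gives `v`, and the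
    -- labels of `u` other than `M` give `T`.
    have hc := key hT hu hv
    rw [h, key hT' hu' hv', List.cons.injEq] at hc
    have huu : u' = u := by
      rw [← flatten_primitiveParts m u, ← hc.1, flatten_primitiveParts]
    subst huu
    have hvv : v = v' := List.append_cancel_left h
    subst hvv
    have hTT : insert M T = insert M T' := by
      rw [← toFinset_labels_of_mem_paths (Finset.mem_filter.1 hu).1,
        ← toFinset_labels_of_mem_paths (Finset.mem_filter.1 hu').1]
    have hMT : ∀ {T}, T ∈ S.powerset → M ∉ T := fun hT h => hMS (Finset.mem_powerset.1 hT h)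
    have : T = T' := by
      rw [← Finset.erase_insert (hMT hT), hTT, Finset.erase_insert (hMT hT')]
    subst this
    rfl
  · intro w hw
    obtain ⟨T, hT, hMT, u, hu, v, hv, rfl⟩ := exists_split_of_mem_paths
      (Finset.mem_insert_self M S) (hle _ (Finset.Subset.refl _)) hw
    refine ⟨⟨T.erase M, u, v⟩, ?_, rfl⟩
    refine Finset.mem_sigma.2 ⟨?_, Finset.mem_product.2 ⟨?_, ?_⟩⟩
    · exact Finset.mem_powerset.2 (Finset.subset_insert_iff.1 hT)
    · dsimp only
      rwa [Finset.insert_erase hMT]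
    · dsimp only
      have : S \ T.erase M = insert M S \ T := by
        ext a
        simp only [Finset.mem_sdiff, Finset.mem_erase, Finset.mem_insert]
        by_cases haM : a = M
        · subst haM; simp [hMS, hMT]
        · simp [haM]
      rwa [this]
  · rintro ⟨T, u, v⟩ hx
    obtain ⟨hT, hx⟩ := Finset.mem_sigma.1 hx
    obtain ⟨hu, hv⟩ := Finset.mem_product.1 hx
    dsimp only at hT hu hv ⊢
    rw [key hT hu hv, List.length_cons, pow_succ']

theorem paths_empty (m : ℕ) : paths m ∅ = {[]} := by
  have h := card_paths m ∅
  rw [Finset.card_empty, fuss, Finset.card_eq_one] at h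
  obtain ⟨w, hw⟩ := h
  have : [] ∈ paths m ∅ := mem_paths.2 ⟨rfl, rfl⟩
  rw [hw, Finset.mem_singleton] at this
  rw [hw, this]

/-- The two claims are proved together: the generating function for `S` needs the one-compartment
count for `S` itself, which is extracted from the known total at `t = 1`. -/
theorem card_onePaths_and_sum_paths (m : ℕ) (S : Finset ℕ) :
    (∀ k, S.card = k + 1 → (onePaths m S).card = fussLin m k) ∧
      ∀ t, ∑ w ∈ paths m S, t ^ (compartments m w).length = fuss m S.card t := by
  induction hn : S.card using Nat.strong_induction_on generalizing S with
  | _ n ih =>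
  rcases S.eq_empty_or_nonempty with rfl | hne
  · rw [Finset.card_empty] at hn
    subst hn
    refine ⟨by simp, fun t => ?_⟩
    simp [paths_empty, compartments, primitiveParts, primitivePartsAux, groupParts, fuss]
  · obtain ⟨M, S', hS', rfl⟩ : ∃ M S', (∀ a ∈ S', a < M) ∧ S = insert M S' :=
      ⟨S.max' hne, S.erase (S.max' hne), fun a ha => S.lt_max'_of_mem_erase_max' hne ha,
        (Finset.insert_erase (S.max'_mem hne)).symm⟩
    have hM : M ∉ S' := fun h => lt_irrefl _ (hS' M h)
    rw [Finset.card_insert_of_notMem hM] at hn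
    subst hn
    have hcardT : ∀ T ∈ S'.powerset, (insert M T).card = T.card + 1 := fun T hT =>
      Finset.card_insert_of_notMem fun h => hM (Finset.mem_powerset.1 hT h)
    have hinner : ∀ T ∈ S'.powerset, ∀ t,
        ∑ v ∈ paths m (S' \ T), t ^ (compartments m v).length = fuss m (S'.card - T.card) t := by
      intro T hT t
      have hc := Finset.card_sdiff_of_subset (Finset.mem_powerset.1 hT)
      exact (ih _ (by omega) (S' \ T) hc).2 t
    have hone : ∀ T ∈ S'.powerset.erase S',
        (onePaths m (insert M T)).card = fussLin m T.card := by
      intro T hT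
      obtain ⟨hT1, hT2⟩ := Finset.mem_erase.1 hT
      have hlt : T.card < S'.card := Finset.card_lt_card
        (Finset.ssubset_iff_subset_ne.2 ⟨Finset.mem_powerset.1 hT2, hT1⟩)
      exact (ih (T.card + 1) (by omega) _ (hcardT T hT2)).1 _ rfl
    have hfuss : ∀ t, fuss m (S'.card + 1) t =
        t * ∑ T ∈ S'.powerset, fussLin m T.card * fuss m (S'.card - T.card) t := by
      intro t
      rw [fuss_convolution,
        Finset.sum_powerset_apply_card (fun k => fussLin m k * fuss m (S'.card - k) t)]
      simp
    have hsum : ∀ t, ∑ w ∈ paths m (insert M S'), t ^ (compartments m w).length =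
        t * ∑ T ∈ S'.powerset, (onePaths m (insert M T)).card * fuss m (S'.card - T.card) t := by
      intro t
      rw [sum_paths_insert m t hS']
      congr 1
      exact Finset.sum_congr rfl fun T hT => by rw [hinner T hT]
    -- At `t = 1` the recursion and the convolution have equal totals, and by induction equal terms
    -- for `T ≠ S'`. Hence the terms at `T = S'` agree, where the other factor is `fuss m 0 1 = 1`.
    have hall : (onePaths m (insert M S')).card = fussLin m S'.card := by
      have h1 := hsum 1
      simp only [one_pow, Finset.sum_const, smul_eq_mul, mul_one, one_mul] at h1
      rw [card_paths, Finset.card_insert_of_notMem hM, hfuss 1, one_mul,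
        ← Finset.add_sum_erase _ _ (Finset.mem_powerset_self S'),
        ← Finset.add_sum_erase _ _ (Finset.mem_powerset_self S'),
        Finset.sum_congr rfl fun T hT => by rw [← hone T hT]] at h1
      have h2 := Nat.add_right_cancel h1
      simpa [fuss] using h2.symm
    refine ⟨fun k hk => ?_, fun t => ?_⟩
    · rw [hall, Nat.add_right_cancel hk]
    · rw [hsum, hfuss]
      congr 1
      refine Finset.sum_congr rfl fun T hT => ?_
      by_cases hTS : T = S'
      · rw [hTS, hall]
      · rw [hone T (Finset.mem_erase.2 ⟨hTS, hT⟩)]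

theorem sum_paths (m : ℕ) (S : Finset ℕ) (t : ℕ) :
    ∑ w ∈ paths m S, t ^ (compartments m w).length = fuss m S.card t :=
  (card_onePaths_and_sum_paths m S).2 t

/-! ### Whitney's formula. -/

/-- Index triples `(a, b, k)` with `a < b` and `k ∈ K`, for the hyperplanes `x_a - x_b = k`. -/
def hyperplaneIndices (K : Finset ℤ) (n : ℕ) : Finset ((Fin n × Fin n) × ℤ) :=
  (Finset.univ.filter fun p : Fin n × Fin n => p.1 < p.2) ×ˢ K

/-- The intersection of the hyperplanes with index in `J`. -/
noncomputable def flat {n : ℕ} (J : Finset ((Fin n × Fin n) × ℤ)) :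
    AffineSubspace ℝ (Fin n → ℝ) :=
  ⨅ q ∈ J, hyperplane q.1.1 q.1.2 q.2

theorem mem_hyperplane {n : ℕ} {i j : Fin n} {k : ℤ} {x : Fin n → ℝ} :
    x ∈ hyperplane i j k ↔ x i - x j = (k : ℝ) := Iff.rfl

theorem mem_flat {n : ℕ} {J : Finset ((Fin n × Fin n) × ℤ)} {x : Fin n → ℝ} :
    x ∈ flat J ↔ ∀ q ∈ J, x q.1.1 - x q.1.2 = (q.2 : ℝ) := by
  simp only [flat, AffineSubspace.mem_iInf_iff, mem_hyperplane]

theorem le_flat_iff {n : ℕ} {J : Finset ((Fin n × Fin n) × ℤ)}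
    {s : AffineSubspace ℝ (Fin n → ℝ)} :
    s ≤ flat J ↔ ∀ q ∈ J, s ≤ hyperplane q.1.1 q.1.2 q.2 := by
  simp only [flat, le_iInf_iff]

theorem hyperplane_ne_top {n : ℕ} {i j : Fin n} (hij : i < j) (k : ℤ) :
    hyperplane i j k ≠ ⊤ := by
  intro h
  have : (Function.update 0 i (k + 1 : ℝ) : Fin n → ℝ) ∈ hyperplane i j k := by
    rw [h]; trivial
  rw [mem_hyperplane] at this
  simp [Function.update_of_ne hij.ne'] at this

open Classical in
/-- The flat with indices `J`, as an element of the intersection poset. -/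
noncomputable def flatElem {K : Finset ℤ} {n : ℕ} (J : Finset ((Fin n × Fin n) × ℤ))
    (hJ : J ⊆ hyperplaneIndices K n) (h : (flat J : Set (Fin n → ℝ)).Nonempty) :
    IntersectionPoset (braidDeformation K n) :=
  ⟨OrderDual.toDual (flat J), h, J.image fun q => hyperplane q.1.1 q.1.2 q.2,
    Finset.image_subset_image hJ, by
      rw [OrderDual.ofDual_toDual, flat, Finset.coe_image, sInf_image]; rfl⟩

open Classical in
/-- The Möbius value of an element of the intersection poset as a signed count of the families
of hyperplanes with that intersection. -/
theorem mu_ambient_eq (K : Finset ℤ) (n : ℕ) (x : IntersectionPoset (braidDeformation K n)) :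
    IncidenceAlgebra.mu ℤ (ambient (braidDeformation K n)) x =
      ∑ J ∈ (hyperplaneIndices K n).powerset with flat J = OrderDual.ofDual x.1,
        (-1 : ℤ) ^ J.card := by
  set I := hyperplaneIndices K n with hI
  set f : IntersectionPoset (braidDeformation K n) → ℤ := fun x =>
    ∑ J ∈ I.powerset with flat J = OrderDual.ofDual x.1, (-1 : ℤ) ^ J.card with hf
  have hbot : ∀ x : IntersectionPoset (braidDeformation K n),
      ambient (braidDeformation K n) ≤ x := fun x => by
    change OrderDual.ofDual x.1 ≤ ⊤
    exact le_top
  -- The families `J` with `flat J` containing `x` are the subsets of `Ix`, the indices of the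
  -- hyperplanes through `x`. Their alternating sum is `0` unless `Ix` is empty, that is, unless `x`
  -- is the whole space. This is the recursion that determines the Möbius function.
  have key : ∀ x : IntersectionPoset (braidDeformation K n),
      ∑ y ∈ Finset.Icc (ambient _) x, f y = if ambient _ = x then 1 else 0 := by
    intro x
    set Ix := I.filter fun q => OrderDual.ofDual x.1 ≤ hyperplane q.1.1 q.1.2 q.2 with hIx
    have h1 : ∑ y ∈ Finset.Icc (ambient _) x, f y = ∑ J ∈ Ix.powerset, (-1 : ℤ) ^ J.card := by
      simp only [hf]
      rw [Finset.sum_sigma']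
      refine Finset.sum_bij (fun p _ => p.2) ?_ ?_ ?_ (fun _ _ => rfl)
      · rintro ⟨y, J⟩ h
        obtain ⟨hy, hJ⟩ := Finset.mem_sigma.1 h
        obtain ⟨hJI, hJy⟩ := Finset.mem_filter.1 hJ
        have hyx : OrderDual.ofDual x.1 ≤ OrderDual.ofDual y.1 := (Finset.mem_Icc.1 hy).2
        dsimp only at hJy hJI ⊢
        rw [← hJy, le_flat_iff] at hyx
        refine Finset.mem_powerset.2 fun q hq => Finset.mem_filter.2
          ⟨Finset.mem_powerset.1 hJI hq, hyx q hq⟩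
      · rintro ⟨y, J⟩ h ⟨y', J'⟩ h' (rfl : J = J')
        have e1 := (Finset.mem_filter.1 (Finset.mem_sigma.1 h).2).2
        have e2 := (Finset.mem_filter.1 (Finset.mem_sigma.1 h').2).2
        have : y = y' := Subtype.ext (e1.symm.trans e2)
        subst this
        rfl
      · intro J hJ
        have hJx := Finset.mem_powerset.1 hJ
        have hJI : J ⊆ I := hJx.trans (Finset.filter_subset _ _)
        have hle : OrderDual.ofDual x.1 ≤ flat J :=
          le_flat_iff.2 fun q hq => (Finset.mem_filter.1 (hJx hq)).2
        refine ⟨⟨flatElem J hJI (x.2.1.mono hle), J⟩, ?_, rfl⟩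
        refine Finset.mem_sigma.2 ⟨Finset.mem_Icc.2 ⟨hbot _, hle⟩,
          Finset.mem_filter.2 ⟨Finset.mem_powerset.2 hJI, rfl⟩⟩
    rw [h1, Finset.sum_powerset_neg_one_pow_card]
    refine if_congr ?_ rfl rfl
    constructor
    · intro he
      obtain ⟨B, hB, hxB⟩ := x.2.2
      have hB0 : B = ∅ := by
        rw [Finset.eq_empty_iff_forall_notMem]
        intro s hs
        obtain ⟨q, hq, rfl⟩ := Finset.mem_image.1 (hB hs)
        have : q ∈ Ix := Finset.mem_filter.2 ⟨hq, by rw [hxB]; exact sInf_le hs⟩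
        rw [he] at this
        exact absurd this (Finset.notMem_empty _)
      refine Subtype.ext ?_
      have : OrderDual.ofDual x.1 = ⊤ := by rw [hxB, hB0]; simp
      exact this.symm
    · rintro rfl
      rw [Finset.eq_empty_iff_forall_notMem]
      intro q hq
      obtain ⟨hq, hle⟩ := Finset.mem_filter.1 hq
      have hlt := (Finset.mem_filter.1 (Finset.mem_product.1 hq).1).2
      exact hyperplane_ne_top hlt q.2 (top_le_iff.1 hle)
  change _ = f x
  induction x using WellFoundedLT.induction with
  | _ x ih =>
  have hx := key x
  rw [← Finset.Ico_insert_right (hbot x), Finset.sum_insert (by simp)] at hx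
  rw [IncidenceAlgebra.mu_apply, Finset.sum_congr rfl fun y hy => ih y (Finset.mem_Ico.1 hy).2]
  by_cases hax : ambient _ = x
  · subst hax
    simpa using hx.symm
  · rw [if_neg hax] at hx ⊢
    linarith

open Classical in
/-- Whitney's formula for the characteristic polynomial. -/
theorem characteristicPolynomial_eval (K : Finset ℤ) (n : ℕ) (q : ℤ) :
    (characteristicPolynomial (braidDeformation K n)).eval q =
      ∑ J ∈ (hyperplaneIndices K n).powerset, (-1 : ℤ) ^ J.card *
        if (flat J : Set (Fin n → ℝ)).Nonempty then q ^ Module.finrank ℝ (flat J).direction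
        else 0 := by
  rw [characteristicPolynomial, Polynomial.eval_finsetSum]
  simp only [Polynomial.eval_mul, Polynomial.eval_C, Polynomial.eval_pow, Polynomial.eval_X]
  simp only [mul_ite, mul_zero]
  rw [← Finset.sum_filter]
  have h1 : ∀ x : IntersectionPoset (braidDeformation K n),
      IncidenceAlgebra.mu ℤ (ambient (braidDeformation K n)) x *
        q ^ Module.finrank ℝ (OrderDual.ofDual x.1).direction =
      ∑ J ∈ (hyperplaneIndices K n).powerset with flat J = OrderDual.ofDual x.1,
        (-1 : ℤ) ^ J.card * q ^ Module.finrank ℝ (flat J).direction := by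
    intro x
    rw [mu_ambient_eq, Finset.sum_mul]
    refine Finset.sum_congr rfl fun J hJ => ?_
    rw [(Finset.mem_filter.1 hJ).2]
  rw [Finset.sum_congr rfl fun x _ => h1 x, Finset.sum_sigma']
  refine Finset.sum_bij (fun p _ => p.2) ?_ ?_ ?_ (fun _ _ => rfl)
  · rintro ⟨x, J⟩ h
    obtain ⟨hJ, hx⟩ := Finset.mem_filter.1 (Finset.mem_sigma.1 h).2
    refine Finset.mem_filter.2 ⟨hJ, ?_⟩
    dsimp only at hx ⊢
    rw [hx]; exact x.2.1
  · rintro ⟨y, J⟩ h ⟨y', J'⟩ h' (rfl : J = J')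
    have e1 := (Finset.mem_filter.1 (Finset.mem_sigma.1 h).2).2
    have e2 := (Finset.mem_filter.1 (Finset.mem_sigma.1 h').2).2
    have : y = y' := Subtype.ext (e1.symm.trans e2)
    subst this
    rfl
  · intro J hJ
    obtain ⟨hJ, hne⟩ := Finset.mem_filter.1 hJ
    exact ⟨⟨flatElem J (Finset.mem_powerset.1 hJ) hne, J⟩, Finset.mem_sigma.2
      ⟨Finset.mem_univ _, Finset.mem_filter.2 ⟨hJ, rfl⟩⟩, rfl⟩

/-! ### From real flats to solutions modulo `q`. -/

/-- The integer points of the flat with indices `J`. -/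
def IsIntSolution {n : ℕ} (J : Finset ((Fin n × Fin n) × ℤ)) (y : Fin n → ℤ) : Prop :=
  ∀ p ∈ J, y p.1.1 - y p.1.2 = p.2

/-- Taking floors coordinatewise preserves integer differences. -/
theorem exists_isIntSolution_of_mem_flat {n : ℕ} {J : Finset ((Fin n × Fin n) × ℤ)}
    {x : Fin n → ℝ} (hx : x ∈ flat J) : ∃ y, IsIntSolution J y := by
  refine ⟨fun i => ⌊x i⌋, fun p hp => ?_⟩
  have h := mem_flat.1 hx p hp
  have : x p.1.1 = x p.1.2 + (p.2 : ℝ) := by linarith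
  simp [this]

/-- Solving the equations modulo `q` is the same as solving them over the integers, when the
right hand sides are small: some window of `m` consecutive residues contains no coordinate, and
cutting the circle there gives integer coordinates. -/
theorem exists_isIntSolution_of_zmod {m n q : ℕ} (hq : n * m < q)
    {J : Finset ((Fin n × Fin n) × ℤ)} (hJ : ∀ p ∈ J, |p.2| ≤ m)
    {x : Fin n → ZMod q} (hx : ∀ p ∈ J, x p.1.1 - x p.1.2 = (p.2 : ZMod q)) :
    ∃ y, IsIntSolution J y := by
  classical
  have : NeZero q := ⟨by omega⟩
  -- A cut point `c` is bad if some coordinate lies among `c, …, c + m - 1`. There are at most `n *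
  -- m < q` bad points.
  let bad : Finset (ZMod q) :=
    (Finset.univ ×ˢ Finset.range m).image fun z : Fin n × ℕ => x z.1 - (z.2 : ZMod q)
  have hbad : bad.card < Fintype.card (ZMod q) := by
    refine Finset.card_image_le.trans_lt ?_
    simpa [ZMod.card] using hq
  obtain ⟨c, hc⟩ : ∃ c, c ∉ bad := by
    by_contra h
    push Not at h
    have : bad = Finset.univ := Finset.eq_univ_iff_forall.2 h
    rw [this, Finset.card_univ] at hbad
    exact lt_irrefl _ hbad
  have hm : ∀ i, m ≤ (x i - c).val := by
    intro i
    by_contra hlt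
    refine hc (Finset.mem_image.2 ⟨(i, (x i - c).val), ?_, ?_⟩)
    · simpa using hlt
    · simp
  have hlt : ∀ i, (x i - c).val < q := fun i => ZMod.val_lt _
  refine ⟨fun i => ((x i - c).val : ℤ), fun p hp => ?_⟩
  have hcast : (((((x p.1.1 - c).val : ℤ) - (x p.1.2 - c).val - p.2) : ℤ) : ZMod q) = 0 := by
    push_cast
    rw [ZMod.natCast_zmod_val, ZMod.natCast_zmod_val, ← hx p hp]
    ring
  have hdvd := (ZMod.intCast_zmod_eq_zero_iff_dvd _ q).1 hcast
  have h1 := hm p.1.1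
  have h2 := hm p.1.2
  have h3 := hlt p.1.1
  have h4 := hlt p.1.2
  have h5 := abs_le.1 (hJ p hp)
  -- All representatives lie in `[m, q)`, so their differences are below `q - m` in absolute value;
  -- subtracting `p.2` keeps the result below `q`.
  have := Int.eq_zero_of_abs_lt_dvd hdvd (by rw [abs_lt]; constructor <;> omega)
  linarith

/-- The relation on coordinates whose classes parametrize the flat with indices `J`. -/
def coordRel {n : ℕ} (J : Finset ((Fin n × Fin n) × ℤ)) (a b : Fin n) : Prop :=
  ∃ k, ((a, b), k) ∈ J

noncomputable instance instFintypeQuotCoordRel {n : ℕ} (J : Finset ((Fin n × Fin n) × ℤ)) :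
    Fintype (Quot (coordRel J)) :=
  Fintype.ofFinite _

/-- The direction consists of the vectors that are constant on the classes generated by `coordRel
J`. -/
theorem finrank_direction_flat {n : ℕ} {J : Finset ((Fin n × Fin n) × ℤ)} {x : Fin n → ℝ}
    (hx : x ∈ flat J) :
    Module.finrank ℝ (flat J).direction = Fintype.card (Quot (coordRel J)) := by
  classical
  have h : (flat J).direction =
      LinearMap.range (LinearMap.funLeft ℝ ℝ (Quot.mk (coordRel J))) := by
    ext v
    rw [AffineSubspace.mem_direction_iff_eq_vsub_right hx, LinearMap.mem_range]
    constructor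
    · rintro ⟨y, hy, rfl⟩
      refine ⟨Quot.lift (y -ᵥ x) ?_, ?_⟩
      · rintro a b ⟨k, hk⟩
        have h1 := mem_flat.1 hx _ hk
        have h2 := mem_flat.1 hy _ hk
        simp only [vsub_eq_sub, Pi.sub_apply] at h1 h2 ⊢
        linarith
      · ext i
        rfl
    · rintro ⟨g, rfl⟩
      refine ⟨x + LinearMap.funLeft ℝ ℝ (Quot.mk (coordRel J)) g, mem_flat.2 fun q hq => ?_, ?_⟩
      · have h1 := mem_flat.1 hx _ hq
        have h2 : Quot.mk (coordRel J) q.1.1 = Quot.mk (coordRel J) q.1.2 := Quot.sound ⟨q.2, hq⟩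
        simp only [Pi.add_apply, LinearMap.funLeft_apply, h2]
        linarith
      · simp
  rw [h, LinearMap.finrank_range_of_inj
    (LinearMap.funLeft_injective_of_surjective ℝ ℝ _ Quot.mk_surjective), Module.finrank_pi]

-- Translation by the reduction of `y` identifies the solutions modulo `q` with the functions
-- constant on the classes, so the exponent is the dimension of the real flat.
open Classical in
theorem card_zmod_solutions {n q : ℕ} [NeZero q] {J : Finset ((Fin n × Fin n) × ℤ)}
    {y : Fin n → ℤ} (hy : IsIntSolution J y) :
    (Finset.univ.filter fun x : Fin n → ZMod q =>
      ∀ p ∈ J, x p.1.1 - x p.1.2 = (p.2 : ZMod q)).card = q ^ Fintype.card (Quot (coordRel J)) := by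
  have h : q ^ Fintype.card (Quot (coordRel J)) =
      (Finset.univ : Finset (Quot (coordRel J) → ZMod q)).card := by
    rw [Finset.card_univ, Fintype.card_fun, ZMod.card]
  have hy' : ∀ p ∈ J, (y p.1.1 : ZMod q) - (y p.1.2 : ZMod q) = (p.2 : ZMod q) := by
    intro p hp
    rw [← hy p hp]; push_cast; rfl
  rw [h]
  symm
  refine Finset.card_bij (fun g _ i => (y i : ZMod q) + g (Quot.mk _ i)) ?_ ?_ ?_
  · intro g _
    simp only [Finset.mem_filter, Finset.mem_univ, true_and]
    intro p hp
    have h2 : Quot.mk (coordRel J) p.1.1 = Quot.mk (coordRel J) p.1.2 := Quot.sound ⟨p.2, hp⟩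
    rw [h2, ← hy' p hp]
    ring
  · intro g _ g' _ hgg
    funext c
    induction c using Quot.ind with
    | _ i => exact add_left_cancel (congrFun hgg i)
  · intro x hx
    simp only [Finset.mem_filter, Finset.mem_univ, true_and] at hx
    refine ⟨Quot.lift (fun i => x i - (y i : ZMod q)) ?_, Finset.mem_univ _, ?_⟩
    · rintro a b ⟨k, hk⟩
      have h1 := hx _ hk
      have h2 := hy' _ hk
      dsimp only at h1 h2 ⊢
      linear_combination h1 - h2
    · funext i
      simp

open Classical in
/-- For large `q`, the value of the characteristic polynomial at `q` counts the points over
`ℤ / q` that avoid the hyperplanes. -/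
theorem characteristicPolynomial_eval_eq_card {m n q : ℕ} (hq : n * m < q) [NeZero q]
    {K : Finset ℤ} (hK : ∀ k ∈ K, |k| ≤ m) :
    (characteristicPolynomial (braidDeformation K n)).eval (q : ℤ) =
      ((Finset.univ.filter fun x : Fin n → ZMod q =>
        ∀ p ∈ hyperplaneIndices K n, x p.1.1 - x p.1.2 ≠ (p.2 : ZMod q)).card : ℤ) := by
  rw [characteristicPolynomial_eval]
  have h1 : ∀ J ∈ (hyperplaneIndices K n).powerset,
      (if (flat J : Set (Fin n → ℝ)).Nonempty then (q : ℤ) ^ Module.finrank ℝ (flat J).direction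
        else 0) = ∑ x : Fin n → ZMod q,
          if ∀ p ∈ J, x p.1.1 - x p.1.2 = (p.2 : ZMod q) then 1 else 0 := by
    intro J hJ
    rw [Finset.sum_boole]
    split_ifs with hne
    · obtain ⟨x, hx⟩ := hne
      obtain ⟨y, hy⟩ := exists_isIntSolution_of_mem_flat hx
      rw [finrank_direction_flat hx, card_zmod_solutions hy]
      push_cast; rfl
    · rw [Finset.filter_eq_empty_iff.2, Finset.card_empty, Nat.cast_zero]
      intro x _ hx
      obtain ⟨y, hy⟩ := exists_isIntSolution_of_zmod hq
        (fun p hp => hK _ (Finset.mem_product.1 (Finset.mem_powerset.1 hJ hp)).2) hx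
      refine hne ⟨fun i => (y i : ℝ), mem_flat.2 fun p hp => ?_⟩
      rw [← hy p hp]; push_cast; rfl
  rw [Finset.sum_congr rfl fun J hJ => by rw [h1 J hJ]]
  simp only [Finset.mul_sum]
  rw [Finset.sum_comm, ← Finset.sum_boole]
  refine Finset.sum_congr rfl fun x _ => ?_
  simp only [mul_ite, mul_one, mul_zero]
  rw [← Finset.sum_filter]
  -- Inclusion–exclusion at a fixed point `x`: the contributing families are the subsets of the set
  -- of hyperplanes through `x`.
  have h2 : ((hyperplaneIndices K n).powerset.filter fun J =>
      ∀ p ∈ J, x p.1.1 - x p.1.2 = (p.2 : ZMod q)) =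
      ((hyperplaneIndices K n).filter fun p => x p.1.1 - x p.1.2 = (p.2 : ZMod q)).powerset := by
    ext J
    simp only [Finset.mem_filter, Finset.mem_powerset, Finset.subset_iff]
    exact ⟨fun h p hp => ⟨h.1 hp, h.2 p hp⟩, fun h => ⟨fun p hp => (h hp).1, fun p hp => (h hp).2⟩⟩
  rw [h2, Finset.sum_powerset_neg_one_pow_card]
  refine if_congr ?_ rfl rfl
  rw [Finset.filter_eq_empty_iff]

/-! ### Counting the points off the Catalan arrangement. -/

/-- Placements of the elements of `S` on `0, …, R - 1`, each occupying its position and the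
following `m` ones, without overlap; off `S` the function vanishes. -/
def IsPlacement {ι : Type*} (m : ℕ) (S : Finset ι) (R : ℕ) (f : ι → ℕ) : Prop :=
  (∀ i ∉ S, f i = 0) ∧ (∀ i ∈ S, f i + m < R) ∧
    ∀ i ∈ S, ∀ j ∈ S, i ≠ j → f i + m < f j ∨ f j + m < f i

theorem succ_descFactorial_eq (s k : ℕ) :
    (s + 1).descFactorial (k + 1) = s.descFactorial (k + 1) + (k + 1) * s.descFactorial k := by
  rw [Nat.succ_descFactorial_succ, Nat.descFactorial_succ, ← add_mul]
  rcases le_or_gt k s with h | h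
  · congr 1; omega
  · rw [Nat.descFactorial_of_lt h]; simp

/-- Shrinking each block to one cell explains the count. The proof is by recursion on `R`: either
the last cell is free, or one of the `S.card` blocks ends there and is removed; the counts add up by
`succ_descFactorial_eq`. -/
theorem exists_finset_isPlacement {ι : Type*} (m : ℕ) (S : Finset ι) (R : ℕ) :
    ∃ F : Finset (ι → ℕ), (∀ f, f ∈ F ↔ IsPlacement m S R f) ∧
      F.card = (R - m * S.card).descFactorial S.card := by
  classical
  induction R using Nat.strong_induction_on generalizing S with
  | _ R ih =>
  rcases S.eq_empty_or_nonempty with rfl | hne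
  · refine ⟨{0}, fun f => ?_, by simp⟩
    simp [IsPlacement, funext_iff]
  obtain ⟨k, hk⟩ : ∃ k, S.card = k + 1 := ⟨S.card - 1, by have := hne.card_pos; omega⟩
  obtain ⟨i₀, hi₀⟩ := hne
  by_cases hR : R ≤ m
  · refine ⟨∅, fun f => ?_, ?_⟩
    · simp only [Finset.notMem_empty, false_iff]
      intro h
      have := h.2.1 i₀ hi₀
      omega
    · have h1 : R - m * S.card = 0 := by
        rw [hk, mul_add, mul_one]; omega
      rw [h1, hk]; simp
  obtain ⟨R, rfl⟩ : ∃ R', R = R' + 1 := ⟨R - 1, by omega⟩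
  obtain ⟨V, hV, hVc⟩ := ih R (by omega) S
  have hU : ∀ i, ∃ F : Finset (ι → ℕ), (∀ f, f ∈ F ↔ IsPlacement m (S.erase i) (R - m) f) ∧
      F.card = (R - m - m * (S.erase i).card).descFactorial (S.erase i).card :=
    fun i => ih (R - m) (by omega) (S.erase i)
  choose U hU hUc using hU
  have himg : ∀ {i f}, i ∈ S → (f ∈ (U i).image (fun g => Function.update g i (R - m)) ↔
      IsPlacement m S (R + 1) f ∧ f i = R - m) := by
    intro i f hi
    simp only [Finset.mem_image, hU]
    constructor
    · rintro ⟨g, ⟨h1, h2, h3⟩, rfl⟩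
      refine ⟨⟨fun j hj => ?_, fun j hj => ?_, fun j hj l hl hjl => ?_⟩, by simp⟩
      · have hji : j ≠ i := fun h => hj (h ▸ hi)
        rw [Function.update_of_ne hji]
        exact h1 j fun h => hj (Finset.mem_of_mem_erase h)
      · by_cases hji : j = i
        · subst hji; simp; omega
        · rw [Function.update_of_ne hji]
          have := h2 j (Finset.mem_erase.2 ⟨hji, hj⟩)
          omega
      · by_cases hji : j = i
        · subst hji
          rw [Function.update_self, Function.update_of_ne hjl.symm]
          exact Or.inr (h2 l (Finset.mem_erase.2 ⟨hjl.symm, hl⟩))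
        · by_cases hli : l = i
          · subst hli
            rw [Function.update_self, Function.update_of_ne hjl]
            exact Or.inl (h2 j (Finset.mem_erase.2 ⟨hjl, hj⟩))
          · rw [Function.update_of_ne hji, Function.update_of_ne hli]
            exact h3 j (Finset.mem_erase.2 ⟨hji, hj⟩) l (Finset.mem_erase.2 ⟨hli, hl⟩) hjl
    · rintro ⟨⟨h1, h2, h3⟩, hfi⟩
      refine ⟨Function.update f i 0, ⟨fun j hj => ?_, fun j hj => ?_, fun j hj l hl hjl => ?_⟩, ?_⟩
      · by_cases hji : j = i
        · subst hji; simp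
        · rw [Function.update_of_ne hji]
          exact h1 j fun h => hj (Finset.mem_erase.2 ⟨hji, h⟩)
      · obtain ⟨hji, hj⟩ := Finset.mem_erase.1 hj
        rw [Function.update_of_ne hji]
        have := h2 j hj
        rcases h3 j hj i hi hji with h | h <;> omega
      · obtain ⟨hji, hj⟩ := Finset.mem_erase.1 hj
        obtain ⟨hli, hl⟩ := Finset.mem_erase.1 hl
        rw [Function.update_of_ne hji, Function.update_of_ne hli]
        exact h3 j hj l hl hjl
      · rw [Function.update_idem, ← hfi, Function.update_eq_self]
  refine ⟨V ∪ S.biUnion fun i => (U i).image fun g => Function.update g i (R - m),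
    fun f => ?_, ?_⟩
  · rw [Finset.mem_union, hV, Finset.mem_biUnion]
    constructor
    · rintro (⟨h1, h2, h3⟩ | ⟨i, hi, h⟩)
      · exact ⟨h1, fun i hi => (h2 i hi).trans (Nat.lt_succ_self R), h3⟩
      · exact ((himg hi).1 h).1
    · intro h
      by_cases hex : ∃ i ∈ S, f i = R - m
      · obtain ⟨i, hi, hfi⟩ := hex
        exact Or.inr ⟨i, hi, (himg hi).2 ⟨h, hfi⟩⟩
      · push Not at hex
        refine Or.inl ⟨h.1, fun i hi => ?_, h.2.2⟩
        have h1 := h.2.1 i hi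
        have h2 := hex i hi
        omega
  · have hUcard : ∀ i ∈ S, ((U i).image fun g => Function.update g i (R - m)).card =
        (R - m * (k + 1)).descFactorial k := by
      intro i hi
      rw [Finset.card_image_of_injOn, hUc, Finset.card_erase_of_mem hi, hk, Nat.add_sub_cancel,
        Nat.sub_sub, mul_add, mul_one, add_comm m]
      intro f hf g hg hfg
      have hf0 := ((hU i f).1 hf).1 i (Finset.notMem_erase i S)
      have hg0 := ((hU i g).1 hg).1 i (Finset.notMem_erase i S)
      funext j
      by_cases hji : j = i
      · rw [hji, hf0, hg0]
      · have := congrFun hfg j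
        simpa [Function.update_of_ne hji] using this
    rw [Finset.card_union_of_disjoint, Finset.card_biUnion, Finset.sum_congr rfl hUcard,
      Finset.sum_const, hVc, hk, smul_eq_mul]
    · rcases le_or_gt (m * (k + 1)) R with h | h
      · rw [Nat.succ_sub h, succ_descFactorial_eq]
      · have h1 : R + 1 - m * (k + 1) = 0 := by omega
        have h2 : R - m * (k + 1) = 0 := by omega
        have hk0 : k ≠ 0 := by
          rintro rfl
          omega
        obtain ⟨l, rfl⟩ := Nat.exists_eq_succ_of_ne_zero hk0
        rw [h1, h2]; simp
    · intro i hi j hj hij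
      rw [Function.onFun, Finset.disjoint_left]
      intro f hf hf'
      obtain ⟨h, hfi⟩ := (himg hi).1 hf
      have hfj := ((himg hj).1 hf').2
      rcases h.2.2 i hi j hj hij with h | h <;> omega
    · rw [Finset.disjoint_left]
      intro f hf hf'
      obtain ⟨i, hi, hfi⟩ := Finset.mem_biUnion.1 hf'
      have h1 := ((himg hi).1 hfi).2
      have h2 := ((hV f).1 hf).2.1 i hi
      omega

theorem avoids_iff {m n q : ℕ} {x : Fin n → ZMod q} :
    (∀ p ∈ hyperplaneIndices (Finset.Icc (-(m : ℤ)) m) n, x p.1.1 - x p.1.2 ≠ (p.2 : ZMod q)) ↔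
      ∀ a b, a ≠ b → ∀ k : ℤ, |k| ≤ m → x a - x b ≠ (k : ZMod q) := by
  simp only [hyperplaneIndices, Finset.mem_product, Finset.mem_filter, Finset.mem_univ, true_and,
    Finset.mem_Icc, ← abs_le]
  constructor
  · intro h a b hab k hk hx
    rcases lt_or_gt_of_ne hab with hlt | hlt
    · exact h ((a, b), k) ⟨hlt, hk⟩ hx
    · refine h ((b, a), -k) ⟨hlt, by rwa [abs_neg]⟩ ?_
      push_cast
      rw [← hx]; ring
  · rintro h ⟨⟨a, b⟩, k⟩ ⟨hab, hk⟩
    exact h a b hab.ne k hk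

theorem intCast_zmod_ne_of_lt {m q : ℕ} {d k : ℤ} (hk : |k| ≤ m) (h1 : (m : ℤ) < |d|)
    (h2 : |d| + m < q) : (d : ZMod q) ≠ (k : ZMod q) := by
  intro h
  have hdvd := (ZMod.intCast_eq_intCast_iff_dvd_sub d k q).1 h
  have h3 : |k - d| < q := (abs_sub k d).trans_lt (by linarith)
  have := Int.eq_zero_of_abs_lt_dvd hdvd h3
  have hkd : k = d := by linarith
  subst hkd
  linarith

-- Cut the circle at coordinate `0`, which is free. The other offsets from it lie between `m + 1`
-- and `q - m - 1`; lowered by `m + 1`, they are placements of `n` blocks on `q - (m + 1)` cells.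
open Classical in
theorem card_avoiding {m n q : ℕ} [NeZero q] :
    (Finset.univ.filter fun x : Fin (n + 1) → ZMod q =>
        ∀ p ∈ hyperplaneIndices (Finset.Icc (-(m : ℤ)) m) (n + 1),
          x p.1.1 - x p.1.2 ≠ (p.2 : ZMod q)).card =
      q * (q - (m + 1) - m * n).descFactorial n := by
  obtain ⟨F, hF, hFc⟩ := exists_finset_isPlacement m (Finset.univ : Finset (Fin n)) (q - (m + 1))
  have hcard : q * (q - (m + 1) - m * n).descFactorial n =
      ((Finset.univ : Finset (ZMod q)) ×ˢ F).card := by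
    rw [Finset.card_product, hFc, Finset.card_univ, ZMod.card, Finset.card_univ, Fintype.card_fin]
  have hF' : ∀ f, f ∈ F ↔ (∀ i, f i + m < q - (m + 1)) ∧
      ∀ i j, i ≠ j → f i + m < f j ∨ f j + m < f i := by
    intro f; rw [hF]; simp [IsPlacement]
  rw [hcard]
  symm
  simp only [avoids_iff]
  refine Finset.card_bij
    (fun cf _ => Fin.cons cf.1 fun i => cf.1 + ((cf.2 i + (m + 1) : ℕ) : ZMod q)) ?_ ?_ ?_
  · rintro ⟨c, f⟩ hcf
    obtain ⟨h1, h2⟩ := (hF' f).1 (Finset.mem_product.1 hcf).2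
    simp only [Finset.mem_filter, Finset.mem_univ, true_and]
    intro a b hab k hk
    cases a using Fin.cases with
    | zero =>
      cases b using Fin.cases with
      | zero => exact absurd rfl hab
      | succ j =>
        have := h1 j
        rw [Fin.cons_zero, Fin.cons_succ]
        have e : c - (c + ((f j + (m + 1) : ℕ) : ZMod q)) =
            ((-((f j + (m + 1) : ℕ) : ℤ) : ℤ) : ZMod q) := by push_cast; ring
        rw [e]
        refine intCast_zmod_ne_of_lt hk ?_ ?_ <;> rw [abs_neg, Nat.abs_cast] <;> push_cast <;> omega
    | succ i =>
      cases b using Fin.cases with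
      | zero =>
        have := h1 i
        rw [Fin.cons_zero, Fin.cons_succ]
        have e : (c + ((f i + (m + 1) : ℕ) : ZMod q)) - c =
            ((((f i + (m + 1) : ℕ) : ℤ) : ℤ) : ZMod q) := by push_cast; ring
        rw [e]
        refine intCast_zmod_ne_of_lt hk ?_ ?_ <;> rw [Nat.abs_cast] <;> push_cast <;> omega
      | succ j =>
        have hi := h1 i
        have hj := h1 j
        have hij := h2 i j fun h => hab (by rw [h])
        rw [Fin.cons_succ, Fin.cons_succ]
        have e : (c + ((f i + (m + 1) : ℕ) : ZMod q)) - (c + ((f j + (m + 1) : ℕ) : ZMod q)) =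
            ((f i - f j : ℤ) : ZMod q) := by push_cast; ring
        rw [e]
        refine intCast_zmod_ne_of_lt hk ?_ ?_
        · rw [lt_abs]; omega
        · rw [← lt_sub_iff_add_lt, abs_lt]; omega
  · rintro ⟨c, f⟩ hcf ⟨c', f'⟩ hcf' h
    have h1 := ((hF' f).1 (Finset.mem_product.1 hcf).2).1
    have h1' := ((hF' f').1 (Finset.mem_product.1 hcf').2).1
    obtain ⟨hc, hf⟩ := Fin.cons_inj.1 h
    dsimp only at hc hf
    subst hc
    congr 1
    funext i
    have h2 := add_left_cancel (congrFun hf i)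
    have h3 := h1 i
    have h4 := h1' i
    rw [ZMod.natCast_eq_natCast_iff', Nat.mod_eq_of_lt (by omega), Nat.mod_eq_of_lt (by omega)] at h2
    omega
  · intro x hx
    simp only [Finset.mem_filter, Finset.mem_univ, true_and] at hx
    have hv : ∀ i, m + 1 ≤ (x (Fin.succ i) - x 0).val ∧ (x (Fin.succ i) - x 0).val + m < q := by
      intro i
      have hlt := ZMod.val_lt (x (Fin.succ i) - x 0)
      have hx' := hx (Fin.succ i) 0 (Fin.succ_ne_zero i)
      constructor
      · by_contra hc
        refine hx' ((x (Fin.succ i) - x 0).val : ℤ) ?_ ?_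
        · rw [Nat.abs_cast]; omega
        · rw [Int.cast_natCast, ZMod.natCast_zmod_val]
      · by_contra hc
        -- An offset within `m` of `q` is congruent to a forbidden negative `k`.
        refine hx' ((x (Fin.succ i) - x 0).val - q : ℤ) ?_ ?_
        · rw [abs_le]; omega
        · push_cast
          rw [ZMod.natCast_zmod_val, ZMod.natCast_self, sub_zero]
    refine ⟨(x 0, fun i => (x (Fin.succ i) - x 0).val - (m + 1)), ?_, ?_⟩
    · refine Finset.mem_product.2 ⟨Finset.mem_univ _, (hF' _).2 ⟨fun i => ?_, fun i j hij => ?_⟩⟩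
      · have := hv i
        dsimp only
        omega
      · have h1 := hv i
        have h2 := hv j
        by_contra hc
        refine hx (Fin.succ i) (Fin.succ j) (fun h => hij (Fin.succ_injective _ h))
          ((x (Fin.succ i) - x 0).val - (x (Fin.succ j) - x 0).val : ℤ) ?_ ?_
        · dsimp only at hc
          rw [abs_le]; omega
        · push_cast
          rw [ZMod.natCast_zmod_val, ZMod.natCast_zmod_val]
          ring
    · funext a
      cases a using Fin.cases with
      | zero => rfl
      | succ i =>
        rw [Fin.cons_succ]
        dsimp only
        rw [Nat.sub_add_cancel (hv i).1, ZMod.natCast_zmod_val]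
        ring

/-! ### Comparison of the two polynomials. -/

open Polynomial

/-- The polynomial whose value at a natural number `t` is `fuss m n t`. -/
noncomputable def fussPoly (m : ℕ) : ℕ → ℤ[X]
  | 0 => 1
  | n + 1 => X * ∏ i ∈ Finset.range n, (X + C ((m * (n + 1) + 1 + i : ℕ) : ℤ))

theorem natCast_ascFactorial_eq_prod (a n : ℕ) :
    ((a.ascFactorial n : ℕ) : ℤ) = ∏ i ∈ Finset.range n, ((a : ℤ) + i) := by
  rw [Nat.ascFactorial_eq_prod_range]; push_cast; rfl

theorem fussPoly_eval (m n t : ℕ) : (fussPoly m n).eval (t : ℤ) = fuss m n t := by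
  cases n with
  | zero => simp [fussPoly, fuss]
  | succ n =>
    simp only [fussPoly, fuss, eval_mul, eval_X, eval_prod, eval_add, eval_C, Nat.cast_mul,
      natCast_ascFactorial_eq_prod]
    congr 1
    refine Finset.prod_congr rfl fun i _ => ?_
    push_cast; ring

theorem eq_of_eval_natCast_eq {p q : ℤ[X]} (N : ℕ)
    (h : ∀ t : ℕ, N < t → p.eval (t : ℤ) = q.eval (t : ℤ)) : p = q := by
  refine Polynomial.eq_of_infinite_eval_eq p q ?_
  refine ((Set.Ioi_infinite N).image (f := fun t : ℕ => (t : ℤ))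
    Nat.cast_injective.injOn).mono ?_
  rintro _ ⟨t, ht, rfl⟩
  exact h t ht

theorem sum_paths_X_pow (m n : ℕ) :
    ∑ w ∈ paths m (Finset.Icc 1 n), (X : ℤ[X]) ^ (compartments m w).length = fussPoly m n := by
  refine eq_of_eval_natCast_eq 0 fun t _ => ?_
  have h := sum_paths m (Finset.Icc 1 n) t
  rw [Nat.card_Icc, Nat.add_sub_cancel] at h
  rw [fussPoly_eval, ← h, eval_finsetSum]
  simp

theorem natCast_descFactorial_eq_prod {a n : ℕ} (h : n ≤ a + 1) :
    ((a.descFactorial n : ℕ) : ℤ) = ∏ i ∈ Finset.range n, ((a : ℤ) - i) := by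
  rw [Nat.descFactorial_eq_prod_range]
  push_cast
  refine Finset.prod_congr rfl fun i hi => ?_
  have := Finset.mem_range.1 hi
  rw [Nat.cast_sub (by omega)]

theorem characteristicPolynomial_catalanArrangement (m n : ℕ) :
    characteristicPolynomial (catalanArrangement m n) = C ((-1) ^ n) * (fussPoly m n).comp (-X) := by
  -- The bound makes `n * m < q` and keeps every natural subtraction in `card_avoiding` from
  -- truncating.
  refine eq_of_eval_natCast_eq (n * m + n + m + 1) fun q hq => ?_
  have : NeZero q := ⟨by omega⟩
  rw [catalanArrangement, characteristicPolynomial_eval_eq_card (m := m) (by omega)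
    (fun k hk => abs_le.2 (Finset.mem_Icc.1 hk))]
  cases n with
  | zero => simp [hyperplaneIndices, fussPoly]
  | succ n =>
    have h1 : m * n + n + 1 ≤ q - (m + 1) := by
      have : (n + 1) * m = m * n + m := by ring
      omega
    rw [card_avoiding, Nat.cast_mul, natCast_descFactorial_eq_prod (by omega)]
    simp only [fussPoly, eval_mul, eval_C, eval_comp, eval_neg, eval_X, eval_prod, eval_add]
    have h2 : ∀ i : ℕ, -(q : ℤ) + ((m * (n + 1) + 1 + i : ℕ) : ℤ) =
        (-1) * (((q - (m + 1) - m * n : ℕ) : ℤ) - i) := by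
      intro i
      rw [Nat.cast_sub (by omega), Nat.cast_sub (by omega)]
      push_cast; ring
    simp only [h2, Finset.prod_mul_distrib, Finset.prod_const, Finset.card_range]
    rw [pow_succ]
    have h3 : ((-1 : ℤ) ^ n) * (-1) ^ n = 1 := by rw [← mul_pow]; simp
    linear_combination (-(q : ℤ) * ∏ i ∈ Finset.range n,
      (((q - (m + 1) - m * n : ℕ) : ℤ) - i)) * h3

theorem natAbs_coeff_comp_neg_X (p : ℤ[X]) (n j : ℕ) :
    ((C ((-1) ^ n) * p.comp (-X)).coeff j).natAbs = (p.coeff j).natAbs := by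
  have h : (-X : ℤ[X]) = C (-1) * X := by simp
  rw [coeff_C_mul, h, comp_C_mul_X_coeff]
  simp [Int.natAbs_mul, Int.natAbs_pow]

/-- The substitution of `-X` and the global sign only change signs of coefficients. The coefficients
of `fussPoly` are numbers of paths, so the absolute value returns them unchanged. -/
theorem catalanCoeff_eq_card (m n j : ℕ) :
    catalanCoeff m n j =
      ((paths m (Finset.Icc 1 n)).filter fun w => (compartments m w).length = j).card := by
  rw [catalanCoeff, characteristicPolynomial_catalanArrangement, natAbs_coeff_comp_neg_X,
    ← sum_paths_X_pow, finsetSum_coeff]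
  simp only [coeff_X_pow]
  rw [Finset.sum_boole, Int.natAbs_natCast]
  simp only [eq_comm]

end CatalanArr

theorem mainTheorem8 (m n j : ℕ) (hm : 1 ≤ m) :
    {w : List CatalanArr.Step | CatalanArr.IsLabeledDyckPath m n w ∧
      (CatalanArr.compartments m w).length = j}.encard
      = (CatalanArr.catalanCoeff m n j : ℕ∞) := by
  rw [CatalanArr.catalanCoeff_eq_card, ← Set.encard_coe_eq_coe_finsetCard]
  congr 1
  ext w
  simp [CatalanArr.isLabeledDyckPath_iff]
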